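/- Fix an algebraic type (operation symbols of finite arities, possibly including constants); algebras are nonempty, a variety is a class of algebras of this type closed under homomorphic images, subalgebras and direct products, and $\mathbf{L}(\mathcal{V})$ is the lattice of subvarieties of $\mathcal{V}$. An identity is regular if the same variables occur on both sides. The regularization $R(\mathcal{V})$ is the variety axiomatized by all regular identities that hold in $\mathcal{V}$. A variety $\mathcal{V}$ is strongly irregular if $\mathcal{V}\models x\cdot y\approx x$ for some term $x\cdot y$ in which exactly the two variables $x,y$ occur. A pair $(a,b)$ of elements of a lattice is a splitting pair if $a\not\le b$ and every element $c$ satisfies $a\le c$ or $c\le b$. A splitting identity of a splitting pair $(\mathcal{V}_1,\mathcal{V}_2)$ in $\mathbf{L}(\mathcal{V})$ is an identity that axiomatizes $\mathcal{V}_2$ with respect to $\mathcal{V}$, i.e. the members of $\mathcal{V}_2$ are exactly the members of $\mathcal{V}$ satisfying it. **Theorem.** Let $\mathcal{V}$ be a strongly irregular variety and let $(\mathcal{V}_1,\mathcal{V}_2)$ be a splitting pair in $\mathbf{L}(\mathcal{V})$. (1) There is a regular identity $\rho\approx\sigma$ that is a splitting identity of $(\mathcal{V}_1,\mathcal{V}_2)$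 in $\mathbf{L}(\mathcal{V})$. Moreover, for every equational basis $\Sigma$ of $R(\mathcal{V})$ (at least one exists) and every term $x\cdot y$ in which exactly $x,y$ occur and with $\mathcal{V}\models x\cdot y\approx x$, the set $\Sigma\cup\{x\cdot y\approx x\}$ is an equational basis of $\mathcal{V}$ and $\Sigma\cup\{x\cdot y\approx x\}\cup\{\rho\approx\sigma\}$ is an equational basis of $\mathcal{V}_2$. (2) Every regular splitting identity of $(\mathcal{V}_1,\mathcal{V}_2)$ in $\mathbf{L}(\mathcal{V})$, in particular the one in (1), is also a splitting identity of $(\mathcal{V}_1,R(\mathcal{V}_2))$ in $\mathbf{L}(R(\mathcal{V}))$; that is, $(\mathcal{V}_1,R(\mathcal{V}_2))$ is a splitting pair in $\mathbf{L}(R(\mathcal{V}))$ and $R(\mathcal{V}_2)$ is axiomatized by this identity with respect to $R(\mathcal{V})$. -/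

import Mathlib

universe u v

open scoped FirstOrder

namespace UnivAlg

/-! ### Algebras

An algebraic type is a first-order language without relation symbols; constants are its
function symbols of arity `0`. -/

/-- An algebra of type `L`: a nonempty set with an interpretation of every operation symbol. -/
structure Alg (L : FirstOrder.Language.{u, v}) where
  /-- the universe of the algebra -/
  carrier : Type u
  [str : L.Structure carrier]
  [ne : Nonempty carrier]

attribute [instance] Alg.str Alg.ne

instance (L : FirstOrder.Language.{u, v}) : CoeSort (Alg L) (Type u) := ⟨Alg.carrier⟩

/-- The direct product of a family of algebras, with coordinatewise operations. -/
def Alg.prod {L : FirstOrder.Language.{u, v}} {ι : Type u} (A : ι → Alg L) : Alg L where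
  carrier := ∀ i, A i
  str :=
    { funMap := fun f x i => FirstOrder.Language.Structure.funMap f (fun k => x k i)
      RelMap := fun r x => ∀ i, FirstOrder.Language.Structure.RelMap r (fun k => x k i) }

/-- A nonempty subuniverse, as an algebra. -/
def Alg.sub {L : FirstOrder.Language.{u, v}} (A : Alg L) (S : L.Substructure A) (hS : Nonempty S) :
    Alg L where
  carrier := S

/-! ### Varieties -/

/-- A variety: a class of algebras closed under homomorphic images, subalgebras and products. -/
@[ext]
structure Variety (L : FirstOrder.Language.{u, v}) where
  /-- the class of members -/
  algebras : Set (Alg L)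
  hom_closed : ∀ (A B : Alg L) (f : A →[L] B),
    Function.Surjective f → A ∈ algebras → B ∈ algebras
  sub_closed : ∀ (A : Alg L) (S : L.Substructure A) (hS : Nonempty S),
    A ∈ algebras → A.sub S hS ∈ algebras
  prod_closed : ∀ {ι : Type u} (A : ι → Alg L), (∀ i, A i ∈ algebras) → Alg.prod A ∈ algebras

instance (L : FirstOrder.Language.{u, v}) : Membership (Alg L) (Variety L) :=
  ⟨fun V A => A ∈ V.algebras⟩

/-- Varieties of a given type are ordered by inclusion. -/
instance (L : FirstOrder.Language.{u, v}) : PartialOrder (Variety L) :=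
  PartialOrder.lift Variety.algebras fun _ _ h => Variety.ext h

/-! ### Identities -/

/-- An identity: a pair of terms in countably many variables. -/
structure Identity (L : FirstOrder.Language.{u, v}) where
  lhs : L.Term ℕ
  rhs : L.Term ℕ

/-- An identity is regular if the same variables occur on both sides. -/
def Identity.IsRegular {L : FirstOrder.Language.{u, v}} (e : Identity L) : Prop :=
  e.lhs.varFinset = e.rhs.varFinset

/-- The algebra `A` satisfies the identity `e`. -/
def Alg.Satisfies {L : FirstOrder.Language.{u, v}} (A : Alg L) (e : Identity L) : Prop :=
  ∀ a : ℕ → A, e.lhs.realize a = e.rhs.realize a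

/-- The variety `V` satisfies the identity `e`. -/
def Variety.Satisfies {L : FirstOrder.Language.{u, v}} (V : Variety L) (e : Identity L) : Prop :=
  ∀ A ∈ V, A.Satisfies e

theorem Alg.realize_prod {L : FirstOrder.Language.{u, v}} {ι : Type u} (A : ι → Alg L) (t : L.Term ℕ)
    (a : ℕ → Alg.prod A) (i : ι) :
    (t.realize a : Alg.prod A) i = t.realize (fun n => a n i) := by
  induction t with
  | var n => rfl
  | func f ts ih =>
    simp only [FirstOrder.Language.Term.realize_func]
    change FirstOrder.Language.Structure.funMap f (fun k => (ts k).realize a i) = _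
    simp only [ih]

/-- The class of all algebras that satisfy the identities in `S`. -/
def modelClass {L : FirstOrder.Language.{u, v}} (S : Set (Identity L)) : Variety L where
  algebras := {A | ∀ e ∈ S, A.Satisfies e}
  hom_closed := by
    intro A B f hf hA e he b
    choose g hg using hf
    have hb : b = f ∘ (fun n => g (b n)) := by
      funext n
      simp [hg]
    rw [hb, FirstOrder.Language.HomClass.realize_term, FirstOrder.Language.HomClass.realize_term, hA e he]
  sub_closed := by
    intro A T hT hA e he a
    have key (t : L.Term ℕ) :
        T.subtype (t.realize (a : ℕ → T)) = t.realize (T.subtype ∘ (a : ℕ → T)) :=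
      (FirstOrder.Language.HomClass.realize_term T.subtype).symm
    refine T.subtype_injective ?_
    exact (key e.lhs).trans ((hA e he _).trans (key e.rhs).symm)
  prod_closed := by
    intro ι A hA e he a
    funext i
    rw [Alg.realize_prod, Alg.realize_prod]
    exact hA i e he _

/-- `S` is an equational basis of `V`: the members of `V` are exactly the models of `S`. -/
def IsEquationalBasis {L : FirstOrder.Language.{u, v}} (S : Set (Identity L)) (V : Variety L) : Prop :=
  modelClass S = V

/-- The regularization of `V`: the variety axiomatized by the regular identities of `V`. -/
def regularization {L : FirstOrder.Language.{u, v}} (V : Variety L) : Variety L :=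
  modelClass {e | e.IsRegular ∧ V.Satisfies e}

/-- The identity `t(x, y) ≈ x`, where the variables `x` and `y` are those of index `0` and `1`. -/
def projIdentity {L : FirstOrder.Language.{u, v}} (t : L.Term ℕ) : Identity L :=
  ⟨t, FirstOrder.Language.Term.var 0⟩

/-- `t` is a term in which exactly the two variables `x`, `y` occur, and `V` satisfies
`t(x, y) ≈ x`. -/
def WitnessesStrongIrregularity {L : FirstOrder.Language.{u, v}} (V : Variety L) (t : L.Term ℕ) : Prop :=
  t.varFinset = {0, 1} ∧ V.Satisfies (projIdentity t)

/-- `V` is strongly irregular. -/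
def IsStronglyIrregular {L : FirstOrder.Language.{u, v}} (V : Variety L) : Prop :=
  ∃ t : L.Term ℕ, WitnessesStrongIrregularity V t

/-! ### Splittings -/

/-- The pair `(a, b)` splits the ordered set (in practice, the lattice) `P`. -/
def IsSplittingPair {P : Type*} [PartialOrder P] (a b : P) : Prop :=
  ¬ a ≤ b ∧ ∀ c : P, a ≤ c ∨ c ≤ b

/-- `(V₁, V₂)` is a splitting pair in the lattice `Set.Iic V` of subvarieties of `V`. -/
def IsSplittingPairIn {L : FirstOrder.Language.{u, v}} (V V₁ V₂ : Variety L) : Prop :=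
  ∃ (h₁ : V₁ ≤ V) (h₂ : V₂ ≤ V),
    IsSplittingPair (⟨V₁, h₁⟩ : Set.Iic V) (⟨V₂, h₂⟩ : Set.Iic V)

/-- `e` is a splitting identity of the splitting pair `(V₁, V₂)` in the lattice of subvarieties
of `V`: it axiomatizes `V₂` with respect to `V`. -/
def IsSplittingIdentity {L : FirstOrder.Language.{u, v}} (V V₁ V₂ : Variety L) (e : Identity L) : Prop :=
  IsSplittingPairIn V V₁ V₂ ∧ ∀ A : Alg L, A ∈ V₂ ↔ A ∈ V ∧ A.Satisfies e

end UnivAlg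

open UnivAlg

namespace UnivAlg

open FirstOrder FirstOrder.Language

variable {L : FirstOrder.Language.{u, v}}

/-! ### Variables of terms -/

/-! Write `x·y` for the term with `x·y ≈ x` in `V`. Modulo this law, `p ≈ q` is equivalent to the
regular identity `p·q ≈ q·p`. Hence `V` is cut out of `R(V)` by `x·y ≈ x`, and every splitting
identity can be made regular (`satisfies_regularize_iff`, `mem_iff_mem_regularization`).

For part (2), an algebra `A` in `R(V)` decomposes, as in a Płonka sum, into fibres that lie in `V`
(`fibre_mem`). Fibres inherit all identities of `A` (`fibre_satisfies`), and regular identities pass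
back from the fibres to `A` (`satisfies_of_fibre`). So a subvariety `W` of `R(V)` with `W ∩ V ≤ V₂`
lies in `R(V₂)`, which transfers the splitting from `V` to `R(V)`. -/

/-- The set of variables that occur in a term. -/
def vars {α : Type*} : L.Term α → Set α
  | .var a => {a}
  | .func _ ts => ⋃ i, vars (ts i)

theorem coe_varFinset {α : Type*} [DecidableEq α] (t : L.Term α) :
    (t.varFinset : Set α) = vars t := by
  induction t with
  | var a => simp [vars, Term.varFinset]
  | func f ts ih => simp [vars, Term.varFinset, ih]

theorem finite_vars {α : Type*} (t : L.Term α) : (vars t).Finite := by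
  classical
  rw [← coe_varFinset]
  exact Finset.finite_toSet _

theorem isRegular_iff (e : Identity L) : e.IsRegular ↔ vars e.lhs = vars e.rhs := by
  rw [← coe_varFinset, ← coe_varFinset, Finset.coe_inj, Identity.IsRegular]

theorem vars_subst {α β : Type*} (t : L.Term α) (s : α → L.Term β) :
    vars (t.subst s) = ⋃ a ∈ vars t, vars (s a) := by
  induction t with
  | var a => simp [vars, Term.subst]
  | func f ts ih =>
    ext x
    simp only [vars, Term.subst, ih, Set.mem_iUnion]
    grind

theorem vars_relabel {α β : Type*} (t : L.Term α) (g : α → β) :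
    vars (t.relabel g) = g '' vars t := by
  induction t with
  | var a => simp [vars, Term.relabel]
  | func f ts ih => simp [vars, Term.relabel, ih, Set.image_iUnion]

theorem realize_congr_vars {α M : Type*} [L.Structure M] (t : L.Term α) {v w : α → M}
    (h : ∀ x ∈ vars t, v x = w x) : t.realize v = t.realize w := by
  induction t with
  | var a => exact h a rfl
  | func f ts ih =>
    simp only [Term.realize_func]
    congr 1
    funext i
    exact ih i fun x hx => h x (Set.mem_iUnion.2 ⟨i, hx⟩)

/-- An equation between terms in arbitrary variables can be rewritten as an identity. -/
theorem exists_identity {α : Type*} (p q : L.Term α) :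
    ∃ e : Identity L, (vars p = vars q → e.IsRegular) ∧
      ∀ A : Alg L, A.Satisfies e ↔ ∀ v : α → A, p.realize v = q.realize v := by
  -- Only finitely many variables occur, so they can be numbered; `g` need not be injective
  -- elsewhere.
  obtain ⟨g, hg⟩ := Set.countable_iff_exists_injOn.1
    ((finite_vars p).union (finite_vars q)).countable
  refine ⟨⟨p.relabel g, q.relabel g⟩, fun h => ?_, fun A => ⟨fun h v => ?_, fun h a => ?_⟩⟩
  · rw [isRegular_iff]
    simp only [vars_relabel, h]
  · classical
    let w : ℕ → A := fun n =>
      if hn : ∃ x ∈ vars p ∪ vars q, g x = n then v hn.choose else Classical.arbitrary A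
    have hw : ∀ x ∈ vars p ∪ vars q, v x = w (g x) := by
      intro x hx
      have hn : ∃ y ∈ vars p ∪ vars q, g y = g x := ⟨x, hx, rfl⟩
      simp only [w, dif_pos hn]
      rw [hg hn.choose_spec.1 hx hn.choose_spec.2]
    have := h w
    simp only [Term.realize_relabel] at this
    rw [realize_congr_vars p (w := w ∘ g) fun x hx => hw x (.inl hx), this]
    exact (realize_congr_vars q fun x hx => hw x (.inr hx)).symm
  · simp only [Term.realize_relabel]
    exact h _

/-! ### Birkhoff's theorem -/

theorem realize_prod_apply {α ι : Type u} (A : ι → Alg L) (t : L.Term α)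
    (a : α → Alg.prod A) (i : ι) :
    (t.realize a : Alg.prod A) i = t.realize (fun n => a n i) := by
  induction t with
  | var n => rfl
  | func f ts ih =>
    simp only [Term.realize_func]
    change Structure.funMap f (fun k => (ts k).realize a i) = _
    simp only [ih]

/-- The subuniverse generated by a family of elements, given by the values of terms. -/
def termRange {α M : Type*} [L.Structure M] (g : α → M) : L.Substructure M where
  carrier := Set.range fun t : L.Term α => t.realize g
  fun_mem := by
    intro n f x hx
    choose ts hts using hx
    exact ⟨.func f ts, by simp only [Term.realize_func]; congr 1; funext i; exact hts i⟩

/-- Birkhoff's theorem: one factor from `V` for each equation over the variable set `A` that fails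
in `V` gives a product in which the tuples `g` generate a relatively free algebra, and that algebra
maps onto `A`. -/
theorem mem_of_satisfies [L.IsAlgebraic] (V : Variety L) (A : Alg L)
    (hA : ∀ e, V.Satisfies e → A.Satisfies e) : A ∈ V := by
  let ι : Type u := {s : L.Term A × L.Term A //
    ∃ B ∈ V, ∃ v : A → B, s.1.realize v ≠ s.2.realize v}
  choose B hBV w hw using fun i : ι => i.2
  let g : A → Alg.prod B := fun x i => w i x
  let S : L.Substructure (Alg.prod B) := termRange g
  have hS : Nonempty S := ⟨⟨_, .var (Classical.arbitrary A), rfl⟩⟩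
  have key : ∀ s t : L.Term A, s.realize g = t.realize g → s.realize id = t.realize (id : A → A) := by
    intro s t hst
    by_contra hne
    obtain ⟨e, -, he⟩ := exists_identity s t
    have : ¬ V.Satisfies e := fun h => hne ((he A).1 (hA e h) id)
    simp only [Variety.Satisfies, he] at this
    push Not at this
    let i : ι := ⟨(s, t), this⟩
    apply hw i
    have h := congrFun hst i
    rwa [realize_prod_apply, realize_prod_apply] at h
  have hrep : ∀ x : S, ∃ t : L.Term A, t.realize g = x.1 := fun x => x.2
  choose r hr using hrep
  let F : (Alg.prod B).sub S hS →[L] A :=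
    { toFun := fun x => (r x).realize id
      map_fun' := by
        intro n f x
        change Fin n → S at x
        have := key (r (Structure.funMap f x)) (.func f fun k => r (x k)) (by
          rw [hr, Term.realize_func]
          simp only [hr]
          rfl)
        rw [Term.realize_func] at this
        exact this
      map_rel' := fun {n} R _ => isEmptyElim R }
  refine V.hom_closed _ A F (fun a => ?_) (V.sub_closed _ S hS (V.prod_closed B hBV))
  let x : S := ⟨_, .var a, rfl⟩
  exact ⟨x, key (r x) (.var a) (hr x)⟩

/-! ### The binary operation given by a term -/

/-- The value of the term `t` at `x`, `y`. -/
def op {M : Type*} [L.Structure M] (t : L.Term ℕ) (x y : M) : M :=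
  t.realize fun i => if i = 0 then x else y

/-- The term `t(p, q)`. -/
def opTerm {α : Type*} (t : L.Term ℕ) (p q : L.Term α) : L.Term α :=
  t.subst fun i => if i = 0 then p else q

theorem realize_opTerm {α M : Type*} [L.Structure M] (t : L.Term ℕ) (p q : L.Term α) (v : α → M) :
    (opTerm t p q).realize v = op t (p.realize v) (q.realize v) := by
  simp only [opTerm, op, Term.realize_subst]
  congr 1
  funext i
  split_ifs <;> rfl

theorem vars_opTerm {α : Type*} {t : L.Term ℕ} (ht : t.varFinset = {0, 1}) (p q : L.Term α) :
    vars (opTerm t p q) = vars p ∪ vars q := by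
  have h : vars t = {0, 1} := by rw [← coe_varFinset, ht]; simp
  simp [opTerm, vars_subst, h]

theorem op_eq_left {t : L.Term ℕ} {A : Alg L} (h : A.Satisfies (projIdentity t)) (x y : A) :
    op t x y = x := h _

theorem satisfies_projIdentity {t : L.Term ℕ} (ht : t.varFinset = {0, 1}) {A : Alg L}
    (h : ∀ x y : A, op t x y = x) : A.Satisfies (projIdentity t) := by
  intro a
  have hv : vars t = {0, 1} := by rw [← coe_varFinset, ht]; simp
  refine Eq.trans (realize_congr_vars t ?_) (h (a 0) (a 1))
  rw [hv]
  rintro x (rfl | rfl) <;> simp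

/-! ### Regularization -/

theorem le_regularization (V : Variety L) : V ≤ regularization V :=
  fun A hA _ he => he.2 A hA

theorem regularization_mono {V W : Variety L} (h : V ≤ W) : regularization V ≤ regularization W :=
  fun _ hA e he => hA e ⟨he.1, fun B hB => he.2 B (h hB)⟩

theorem realize_eq_of_mem_regularization {V : Variety L} {A : Alg L} (hA : A ∈ regularization V)
    {α : Type*} (p q : L.Term α) (hpq : vars p = vars q)
    (h : ∀ B ∈ V, ∀ v : α → B, p.realize v = q.realize v) (v : α → A) :
    p.realize v = q.realize v := by
  obtain ⟨e, he, hs⟩ := exists_identity p q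
  exact (hs A).1 (hA e ⟨he hpq, fun B hB => (hs B).2 (h B hB)⟩) v

/-- The identity `t(p, q) ≈ t(q, p)`, which in the presence of `t(x, y) ≈ x` is equivalent to
`p ≈ q`. -/
def regularize (t : L.Term ℕ) (e : Identity L) : Identity L :=
  ⟨opTerm t e.lhs e.rhs, opTerm t e.rhs e.lhs⟩

theorem regularize_isRegular {t : L.Term ℕ} (ht : t.varFinset = {0, 1}) (e : Identity L) :
    (regularize t e).IsRegular := by
  rw [isRegular_iff]
  simp only [regularize, vars_opTerm ht, Set.union_comm]

theorem satisfies_regularize_iff {t : L.Term ℕ} {A : Alg L} (h : A.Satisfies (projIdentity t))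
    (e : Identity L) : A.Satisfies (regularize t e) ↔ A.Satisfies e := by
  simp only [Alg.Satisfies, regularize, realize_opTerm, op_eq_left h]

theorem mem_iff_mem_regularization [L.IsAlgebraic] {V : Variety L} {t : L.Term ℕ}
    (ht : WitnessesStrongIrregularity V t) (A : Alg L) :
    A ∈ V ↔ A ∈ regularization V ∧ A.Satisfies (projIdentity t) := by
  refine ⟨fun hA => ⟨le_regularization V hA, ht.2 A hA⟩, fun ⟨hA, hp⟩ => ?_⟩
  refine mem_of_satisfies V A fun e he => (satisfies_regularize_iff hp e).1 (hA _ ⟨?_, ?_⟩)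
  · exact regularize_isRegular ht.1 e
  · exact fun B hB => (satisfies_regularize_iff (ht.2 B hB) e).2 (he B hB)

/-! ### Fibres of the Płonka sum decomposition -/

section Fibre

variable {V : Variety L} {t : L.Term ℕ} {A : Alg L}

/-- The source of the laws in this section: both sides contain the same variables and collapse to
the same term under `x·y ≈ x`, so the equation is regular and true in `V`. -/
theorem op_op_right (ht : WitnessesStrongIrregularity V t) (hA : A ∈ regularization V)
    (x y z : A) : op t (op t x y) z = op t x (op t z y) := by
  have := realize_eq_of_mem_regularization hA
    (opTerm t (opTerm t (.var 0) (.var 1)) (.var 2))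
    (opTerm t (.var 0) (opTerm t (.var 2) (.var 1)))
    (by simp only [vars_opTerm ht.1, Set.union_assoc, Set.union_comm])
    (fun B hB v => by simp only [realize_opTerm, op_eq_left (ht.2 B hB)])
    (![x, y, z] : Fin 3 → A)
  simpa [realize_opTerm] using this

theorem op_self (ht : WitnessesStrongIrregularity V t) (hA : A ∈ regularization V) (x : A) :
    op t x x = x := by
  have := realize_eq_of_mem_regularization hA (opTerm t (.var ()) (.var ())) (.var ())
    (by simp [vars_opTerm ht.1])
    (fun B hB v => by simp only [realize_opTerm, op_eq_left (ht.2 B hB)])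
    (fun _ => x)
  simpa [realize_opTerm] using this

theorem op_right_right (ht : WitnessesStrongIrregularity V t) (hA : A ∈ regularization V)
    (x y : A) : op t (op t x y) y = op t x y := by
  rw [op_op_right ht hA, op_self ht hA]

theorem op_op_left (ht : WitnessesStrongIrregularity V t) (hA : A ∈ regularization V)
    (x y : A) : op t x (op t y x) = op t x y := by
  rw [← op_op_right ht hA, op_self ht hA]

theorem op_funMap_op_right (ht : WitnessesStrongIrregularity V t) (hA : A ∈ regularization V)
    {n : ℕ} (f : L.Functions n) (x : Fin n → A) (y : A) :
    op t (Structure.funMap f fun i => op t (x i) y) y = op t (Structure.funMap f x) y := by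
  have := realize_eq_of_mem_regularization hA
    (opTerm t (.func f fun i => opTerm t (.var (some i)) (.var none)) (.var none))
    (opTerm t (.func f fun i => .var (some i)) (.var none))
    (by
      ext z
      simp only [vars_opTerm ht.1, vars, Set.mem_union, Set.mem_iUnion]
      grind)
    (fun B hB v => by
      simp only [realize_opTerm, op_eq_left (ht.2 B hB), Term.realize_func])
    (fun o : Option (Fin n) => o.elim y x)
  simpa [realize_opTerm] using this

theorem op_funMap_eq_self (ht : WitnessesStrongIrregularity V t) (hA : A ∈ regularization V)
    {n : ℕ} (f : L.Functions n) (x : Fin n → A) (y : A) (h : ∀ i, op t y (x i) = y) :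
    op t y (Structure.funMap f x) = y := by
  have h₁ := realize_eq_of_mem_regularization hA
    (opTerm t (.var none) (.func f fun i => .var (some i)))
    (opTerm t (.var none) (.func f fun i => opTerm t (.var none) (.var (some i))))
    (by
      ext z
      simp only [vars_opTerm ht.1, vars, Set.mem_union, Set.mem_iUnion]
      grind)
    (fun B hB v => by simp only [realize_opTerm, op_eq_left (ht.2 B hB)])
    (fun o : Option (Fin n) => o.elim y x)
  -- By `h`, the right side of `h₁` becomes `y·f(y,…,y)`. A constant `f` is covered, since `y` still
  -- occurs on both sides.
  have h₂ := realize_eq_of_mem_regularization hA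
    (opTerm t (.var ()) (.func f fun _ => .var ())) (.var ())
    (by
      ext z
      simp [vars_opTerm ht.1, vars])
    (fun B hB v => by simp only [realize_opTerm, op_eq_left (ht.2 B hB)])
    (fun _ => y)
  simp only [realize_opTerm, Term.realize_func, Term.realize_var, Option.elim, h] at h₁ h₂
  exact h₁.trans h₂

/-- The Płonka fibre of `b`. An operation is evaluated in `A` and then moved into the fibre, so
that constants, which need not lie in it, are interpreted too. -/
def fibre [L.IsAlgebraic] (ht : WitnessesStrongIrregularity V t) (hA : A ∈ regularization V)
    (b : A) : Alg L where
  carrier := {x : A // op t b x = b ∧ op t x b = x}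
  str :=
    { funMap := fun f x => ⟨op t (Structure.funMap f fun i => (x i).1) b, by
        rw [op_op_left ht hA]
        exact op_funMap_eq_self ht hA f _ b fun i => (x i).2.1,
        op_right_right ht hA _ _⟩
      RelMap := fun R _ => isEmptyElim R }
  ne := ⟨⟨b, op_self ht hA b, op_self ht hA b⟩⟩

theorem coe_realize_fibre [L.IsAlgebraic] (ht : WitnessesStrongIrregularity V t)
    (hA : A ∈ regularization V) (b : A) {α : Type*} (p : L.Term α) (v : α → fibre ht hA b) :
    (p.realize v : fibre ht hA b).1 = op t (p.realize fun i => (v i).1) b := by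
  induction p with
  | var i => exact (v i).2.2.symm
  | func f ts ih =>
    simp only [Term.realize_func]
    change op t (Structure.funMap f fun i => ((ts i).realize v : fibre ht hA b).1) b = _
    simp only [ih]
    exact op_funMap_op_right ht hA f _ b

/-- A term value in the fibre is its value in `A` multiplied on the right by `b`; regularity of `e`
plays no role. -/
theorem fibre_satisfies [L.IsAlgebraic] (ht : WitnessesStrongIrregularity V t)
    (hA : A ∈ regularization V) (b : A) {e : Identity L} (he : A.Satisfies e) :
    (fibre ht hA b).Satisfies e := by
  intro a
  apply Subtype.ext
  rw [coe_realize_fibre, coe_realize_fibre, he]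

theorem fibre_mem [L.IsAlgebraic] (ht : WitnessesStrongIrregularity V t)
    (hA : A ∈ regularization V) (b : A) : fibre ht hA b ∈ V := by
  refine (mem_iff_mem_regularization ht _).2
    ⟨fun e he => fibre_satisfies ht hA b (hA e he), satisfies_projIdentity ht.1 fun x y => ?_⟩
  apply Subtype.ext
  rw [op, coe_realize_fibre]
  have : (fun i : ℕ => (if i = 0 then x else y).1) = fun i => if i = 0 then x.1 else y.1 := by
    funext i
    split_ifs <;> rfl
  rw [this]
  change op t (op t x.1 y.1) b = x.1
  rw [op_op_right ht hA, y.2.1, x.2.2]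

/-- A regular identity that holds in all fibres of `A` holds in `A`. -/
theorem satisfies_of_fibre [L.IsAlgebraic] (ht : WitnessesStrongIrregularity V t)
    (hA : A ∈ regularization V) {e : Identity L} (he : e.IsRegular)
    (h : ∀ b : A, (fibre ht hA b).Satisfies e) : A.Satisfies e := by
  classical
  rw [isRegular_iff] at he
  intro a
  obtain ⟨p, q⟩ := e
  change vars p = vars q at he
  change p.realize a = q.realize a
  -- The fibre of the common value: `p` contains each of its variables, so multiplying the
  -- corresponding `a i` on the right by `b` lands in this fibre.
  let b : A := p.realize a
  have hmem : ∀ i ∈ vars p, op t b (op t (a i) b) = b := by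
    intro i hi
    have := realize_eq_of_mem_regularization hA (opTerm t p (opTerm t (.var i) p)) p
      (by simpa [vars_opTerm ht.1, vars] using hi)
      (fun B hB v => by simp only [realize_opTerm, op_eq_left (ht.2 B hB)]) a
    simpa only [realize_opTerm, Term.realize_var] using this
  have hval : ∀ r : L.Term ℕ, vars r = vars p →
      op t (r.realize fun i => op t (a i) b) b = r.realize a := by
    intro r hr
    have := realize_eq_of_mem_regularization hA
      (opTerm t (r.subst fun i => opTerm t (.var i) p) p) r
      (by
        ext x
        simp only [vars_opTerm ht.1, vars_subst, hr, vars, Set.mem_union, Set.mem_iUnion]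
        grind)
      (fun B hB v => by
        simp only [realize_opTerm, op_eq_left (ht.2 B hB), Term.realize_subst,
          Term.realize_var]) a
    simpa only [realize_opTerm, Term.realize_subst, Term.realize_var] using this
  let c : ℕ → fibre ht hA b := fun i =>
    if hi : i ∈ vars p then ⟨op t (a i) b, hmem i hi, op_right_right ht hA _ _⟩
    -- Any element of the fibre would do for variables that do not occur.
    else ⟨b, op_self ht hA b, op_self ht hA b⟩
  have hc : ∀ r : L.Term ℕ, vars r = vars p → (r.realize c : fibre ht hA b).1 = r.realize a := by
    intro r hr
    rw [coe_realize_fibre, ← hval r hr]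
    congr 1
    refine realize_congr_vars r fun x hx => ?_
    rw [hr] at hx
    exact congrArg Subtype.val (dif_pos hx)
  rw [← hc p rfl, ← hc q he.symm]
  exact congrArg Subtype.val (h b c)

end Fibre

/-! ### Splittings -/

/-- The intersection of two varieties. -/
def Variety.inter (V W : Variety L) : Variety L where
  algebras := V.algebras ∩ W.algebras
  hom_closed := fun A B f hf h => ⟨V.hom_closed A B f hf h.1, W.hom_closed A B f hf h.2⟩
  sub_closed := fun A S hS h => ⟨V.sub_closed A S hS h.1, W.sub_closed A S hS h.2⟩
  prod_closed := fun A h =>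
    ⟨V.prod_closed A fun i => (h i).1, W.prod_closed A fun i => (h i).2⟩

theorem isSplittingPairIn_iff {V V₁ V₂ : Variety L} :
    IsSplittingPairIn V V₁ V₂ ↔
      V₁ ≤ V ∧ V₂ ≤ V ∧ ¬ V₁ ≤ V₂ ∧ ∀ W : Variety L, W ≤ V → V₁ ≤ W ∨ W ≤ V₂ :=
  ⟨fun ⟨h₁, h₂, h₃, h₄⟩ => ⟨h₁, h₂, h₃, fun W hW => h₄ ⟨W, hW⟩⟩,
    fun ⟨h₁, h₂, h₃, h₄⟩ => ⟨h₁, h₂, h₃, fun W => h₄ W.1 W.2⟩⟩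

/-- An identity of `V₂` that fails in some member of `V₁` works: the subvariety of `V` it defines
does not contain `V₁`, so it lies below `V₂`. -/
theorem exists_isSplittingIdentity [L.IsAlgebraic] {V V₁ V₂ : Variety L}
    (h : IsSplittingPairIn V V₁ V₂) : ∃ e, IsSplittingIdentity V V₁ V₂ e := by
  obtain ⟨-, h₂, hne, hs⟩ := isSplittingPairIn_iff.1 h
  obtain ⟨A, hA₁, hA₂⟩ := Set.not_subset.1 hne
  have : ∃ e, V₂.Satisfies e ∧ ¬ A.Satisfies e := by
    by_contra! hcon
    exact hA₂ (mem_of_satisfies V₂ A hcon)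
  obtain ⟨e, he, hAe⟩ := this
  refine ⟨e, h, fun B => ⟨fun hB => ⟨h₂ hB, he B hB⟩, fun ⟨hB, hBe⟩ => ?_⟩⟩
  rcases hs (V.inter (modelClass {e})) (fun _ hC => hC.1) with h' | h'
  · exact absurd ((h' hA₁).2 e rfl) hAe
  · exact h' ⟨hB, fun e' he' => by rwa [Set.mem_singleton_iff.1 he']⟩

theorem IsSplittingIdentity.regularize {V V₁ V₂ : Variety L} {t : L.Term ℕ}
    (ht : WitnessesStrongIrregularity V t) {e : Identity L} (h : IsSplittingIdentity V V₁ V₂ e) :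
    IsSplittingIdentity V V₁ V₂ (regularize t e) := by
  refine ⟨h.1, fun A => (h.2 A).trans (and_congr_right fun hA => ?_)⟩
  exact (satisfies_regularize_iff (ht.2 A hA) e).symm

theorem isEquationalBasis_iff {S : Set (Identity L)} {V : Variety L} :
    IsEquationalBasis S V ↔ ∀ A : Alg L, (∀ e ∈ S, A.Satisfies e) ↔ A ∈ V :=
  ⟨fun h A => by rw [← h]; rfl, fun h => Variety.ext (Set.ext h)⟩

theorem IsEquationalBasis.union_singleton {S : Set (Identity L)} {V W : Variety L} {e : Identity L}
    (hS : IsEquationalBasis S V) (h : ∀ A : Alg L, A ∈ W ↔ A ∈ V ∧ A.Satisfies e) :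
    IsEquationalBasis (S ∪ {e}) W := by
  rw [isEquationalBasis_iff] at hS ⊢
  intro A
  rw [h, ← hS]
  simp [or_imp, forall_and, and_comm]

/-- A subvariety of the regularization of `V` lies in the regularization of `V₂` as soon as its
members in `V` lie in `V₂`. -/
theorem le_regularization_of_inter_le [L.IsAlgebraic] {V V₂ W : Variety L}
    (hV : IsStronglyIrregular V) (hW : W ≤ regularization V) (h : W.inter V ≤ V₂) :
    W ≤ regularization V₂ := by
  obtain ⟨t, ht⟩ := hV
  intro A hA e he
  refine satisfies_of_fibre ht (hW hA) he.1 fun b => he.2 _ (h ⟨?_, fibre_mem ht (hW hA) b⟩)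
  -- The fibre satisfies every identity of `W`, because `A` does.
  exact mem_of_satisfies W _ fun e' he' => fibre_satisfies ht (hW hA) b (he' A hA)

theorem IsSplittingIdentity.regularization [L.IsAlgebraic] {V V₁ V₂ : Variety L}
    (hV : IsStronglyIrregular V) {e : Identity L} (he : e.IsRegular)
    (h : IsSplittingIdentity V V₁ V₂ e) :
    IsSplittingIdentity (regularization V) V₁ (regularization V₂) e := by
  obtain ⟨h₁, h₂, hne, hs⟩ := isSplittingPairIn_iff.1 h.1
  have hsat : ∀ A ∈ UnivAlg.regularization V₂, A.Satisfies e := fun A hA =>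
    hA e ⟨he, fun B hB => ((h.2 B).1 hB).2⟩
  refine ⟨isSplittingPairIn_iff.2 ⟨h₁.trans (le_regularization V), regularization_mono h₂,
    fun hle => hne fun A hA => (h.2 A).2 ⟨h₁ hA, hsat A (hle hA)⟩, fun W hW => ?_⟩, fun A => ?_⟩
  · rcases hs (W.inter V) (fun _ hC => hC.2) with h' | h'
    · exact .inl fun A hA => (h' hA).1
    · exact .inr (le_regularization_of_inter_le hV hW h')
  · refine ⟨fun hA => ⟨regularization_mono h₂ hA, hsat A hA⟩, fun ⟨hA, hAe⟩ => ?_⟩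
    -- The members of this variety that lie in `V` satisfy `e`, hence lie in `V₂`.
    refine le_regularization_of_inter_le (W := (UnivAlg.regularization V).inter (modelClass {e}))
      hV (fun _ hC => hC.1) (fun B hB => (h.2 B).2 ⟨hB.2, hB.1.2 e rfl⟩) ⟨hA, ?_⟩
    exact fun e' he' => by rwa [Set.mem_singleton_iff.1 he']

end UnivAlg

open UnivAlg
theorem mainTheorem6 (L : FirstOrder.Language.{u, v}) [L.IsAlgebraic]
    (V : Variety L) (hV : IsStronglyIrregular V)
    (V₁ V₂ : Variety L) (hsplit : IsSplittingPairIn V V₁ V₂) :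
    -- a regular splitting identity, relative to every (and some) basis of the special form
    (∃ e : Identity L, e.IsRegular ∧ IsSplittingIdentity V V₁ V₂ e ∧
      (∃ (S : Set (Identity L)) (t : L.Term ℕ),
        IsEquationalBasis S (regularization V) ∧ WitnessesStrongIrregularity V t) ∧
      ∀ (S : Set (Identity L)) (t : L.Term ℕ),
        IsEquationalBasis S (regularization V) → WitnessesStrongIrregularity V t →
          IsEquationalBasis (S ∪ {projIdentity t}) V ∧
          IsEquationalBasis (S ∪ {projIdentity t} ∪ {e}) V₂) ∧
    -- the same regular identity is the splitting identity in the regularization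
    (∀ e : Identity L, e.IsRegular → IsSplittingIdentity V V₁ V₂ e →
      IsSplittingIdentity (regularization V) V₁ (regularization V₂) e) := by
  refine ⟨?_, fun e he h => h.regularization hV he⟩
  obtain ⟨t₀, ht₀⟩ := hV
  obtain ⟨e, he⟩ := exists_isSplittingIdentity hsplit
  have he' := he.regularize ht₀
  refine ⟨regularize t₀ e, regularize_isRegular ht₀.1 e, he', ⟨_, t₀, rfl, ht₀⟩,
    fun S t hS ht => ?_⟩
  -- Here `t` may differ from the `t₀` used to build the identity: only its being a splitting
  -- identity matters.
  have hb := hS.union_singleton (mem_iff_mem_regularization ht)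
  exact ⟨hb, hb.union_singleton he'.2⟩
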